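/- Let $n\ge 1$ and $\lambda>0$, and let $\mathbb{M}^n=(\mathbb{R}^n,\|\cdot\|)$ with $\|x\|=\|x\|_1+\lambda\|x\|_2$. For a finite set $N\subset\mathbb{R}^n$, a Steiner tree of $N$ is a finite tree $T$ whose vertices are distinct points of $\mathbb{R}^n$ and whose vertex set $V(T)$ contains $N$; its length is $\sum_{xy\in E(T)}\|x-y\|$, and a Steiner minimal tree (SMT) of $N$ is a Steiner tree of $N$ of minimum length among all Steiner trees of $N$. In an SMT of $N$ the points of $N$ are called given points, and the points of $V(T)\setminus N$ are called Steiner points. Let $d(\mathbb{M}^n)$ be the maximum degree of a given point, and $s(\mathbb{M}^n)$ the maximum degree of a Steiner point, over all SMTs of all finite sets $N\subset\mathbb{R}^n$ (the supremum in $\mathbb{N}\cup\{\infty\}$). Then: 1. If $\lambda\le 1$, then $s(\mathbb{M}^n)\le d(\mathbb{M}^n)\le 2n$. 2. If $\lambda\le \sqrt n/(\sqrt n-1)$ (no condition on $\lambda$ when $n=1$), then $d(\mathbb{M}^n)\ge s(\mathbb{M}^n)\ge 2n$. Moreover, in this case the star joining the origin $o$ to the $2n$ points $\pm e_i$, $1\le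 i\le n$ (with $e_i$ the standard unit vectors), is an SMT of $\{\pm e_i: 1\le i\le n\}$ in which $o$ is a Steiner point of degree $2n$. -/

import Mathlib

noncomputable section

/-- A finite tree whose vertices are (distinct) points of the space `E`. -/
structure PointTree (E : Type*) where
  /-- the finite set of vertices -/
  verts : Finset E
  /-- the adjacency relation on the vertices -/
  graph : SimpleGraph verts
  isTree : graph.IsTree

namespace PointTree

variable {E : Type*} [AddCommGroup E] [Module ℝ E]

open Classical in
/-- The length of a tree for the norm `p`: the sum of `p (x - y)` over all its edges `xy`. -/
def length (p : Seminorm ℝ E) (T : PointTree E) : ℝ :=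
  ∑ e ∈ T.graph.edgeFinset,
    Sym2.lift ⟨fun x y : T.verts => p ((x : E) - (y : E)), fun _ _ => map_sub_rev p _ _⟩ e

/-- `T` is a Steiner tree of the finite set `N`: every point of `N` is a vertex of `T`. -/
def IsSteinerTree {E : Type*} (T : PointTree E) (N : Finset E) : Prop :=
  N ⊆ T.verts

/-- `T` is a Steiner minimal tree of `N`: a shortest one among all Steiner trees of `N`. -/
def IsSMT (p : Seminorm ℝ E) (T : PointTree E) (N : Finset E) : Prop :=
  T.IsSteinerTree N ∧ ∀ T' : PointTree E, T'.IsSteinerTree N → T.length p ≤ T'.length p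

/-- The degree of a vertex of the tree. -/
def degree {E : Type*} (T : PointTree E) (v : T.verts) : ℕ∞ :=
  (T.graph.neighborSet v).encard

open Classical in
/-- The star joining the centre `c` to every point of `A`. -/
def star {E : Type*} (c : E) (A : Finset E) : PointTree E where
  verts := insert c A
  graph := SimpleGraph.starGraph ⟨c, Finset.mem_insert_self c A⟩
  isTree := SimpleGraph.isTree_starGraph _

theorem centre_mem_star {E : Type*} (c : E) (A : Finset E) : c ∈ (star c A).verts := by
  simp [star]

end PointTree

/-- `d(M)`: the supremum in `ℕ∞` of the degrees of the given points in Steiner minimal trees of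
finite sets `N`. -/
def maxNodeDegree {E : Type*} [AddCommGroup E] [Module ℝ E] (p : Seminorm ℝ E) : ℕ∞ :=
  ⨆ (N : Finset E) (T : PointTree E) (_ : T.IsSMT p N) (v : T.verts) (_ : (v : E) ∈ N), T.degree v

/-- `s(M)`: the supremum in `ℕ∞` of the degrees of the Steiner points (the vertices that are not
given points) in Steiner minimal trees of finite sets `N`. -/
def maxSteinerDegree {E : Type*} [AddCommGroup E] [Module ℝ E] (p : Seminorm ℝ E) : ℕ∞ :=
  ⨆ (N : Finset E) (T : PointTree E) (_ : T.IsSMT p N) (v : T.verts) (_ : (v : E) ∉ N), T.degree v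

/-- The norm `‖x‖₁ + lam ‖x‖₂` on `ℝⁿ`. -/
def l1AddL2 (n : ℕ) (lam : ℝ) (hlam : 0 < lam) : Seminorm ℝ (Fin n → ℝ) :=
  Seminorm.of (fun x => ‖WithLp.toLp 1 x‖ + lam * ‖WithLp.toLp 2 x‖)
    (fun x y => by
      have h1 := norm_add_le (WithLp.toLp 1 x) (WithLp.toLp 1 y)
      have h2 := mul_le_mul_of_nonneg_left
        (norm_add_le (WithLp.toLp 2 x) (WithLp.toLp 2 y)) hlam.le
      rw [WithLp.toLp_add, WithLp.toLp_add]
      linarith)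
    (fun a x => by
      rw [WithLp.toLp_smul, WithLp.toLp_smul, norm_smul, norm_smul]
      ring)

/-- It is a norm, not only a seminorm. -/
theorem l1AddL2_eq_zero_iff (n : ℕ) (lam : ℝ) (hlam : 0 < lam) (x : Fin n → ℝ) :
    l1AddL2 n lam hlam x = 0 ↔ x = 0 := by
  refine ⟨fun h => ?_, fun h => by rw [h, map_zero]⟩
  have h' : ‖WithLp.toLp 1 x‖ + lam * ‖WithLp.toLp 2 x‖ = 0 := h
  have h2 : 0 ≤ lam * ‖WithLp.toLp 2 x‖ := mul_nonneg hlam.le (norm_nonneg _)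
  have h1 : ‖WithLp.toLp 1 x‖ = 0 := le_antisymm (by linarith) (norm_nonneg _)
  simpa using h1

/-- The `2n` points `±eᵢ` of `ℝⁿ`. -/
def crossPoints (n : ℕ) : Finset (Fin n → ℝ) :=
  Finset.univ.image (fun i : Fin n => Pi.single i (1 : ℝ)) ∪
    Finset.univ.image (fun i : Fin n => -Pi.single i (1 : ℝ))

/-- The star joining the origin to the points `±eᵢ`. -/
def crossStar (n : ℕ) : PointTree (Fin n → ℝ) :=
  PointTree.star 0 (crossPoints n)

theorem zero_mem_crossStar (n : ℕ) : (0 : Fin n → ℝ) ∈ (crossStar n).verts :=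
  PointTree.centre_mem_star 0 (crossPoints n)

end

/-! Star: its length is at most `n * (2 * lam + 2)`, and a weighted edge count shows that no tree
through the points ±eᵢ is shorter. Fix i. The edges separating eᵢ from -eᵢ carry a total increment
of xᵢ of at least 2; count it with weight `lam`. The edges that do not separate them, or that cut
one of them off from all the other points ±eⱼ, also carry at least 2 (`two_le_sum_edgeDiff`); count
it with weight 1. An edge with difference vector v is long enough to pay for all coordinates at once
(`sum_weighted_edgeDiff_le`). If it cuts off ±eᵢ alone, it separates no other pair, so it owes at
most ‖v‖₁ + lam |vᵢ|. Otherwise each coordinate has weight either `lam` or 1, and the upper bound on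
`lam` makes such a functional have dual norm at most 1. Degree: when `lam ≤ 1`, two edges at a
vertex with positive components along the same ±eⱼ can be merged along that direction to shorten the
tree (`eq_of_mul_pos`). Hence each of the 2n signed directions serves at most one edge. -/

namespace SimpleGraph

/-! ### Edges separating vertices of a connected graph. -/

variable {V : Type*} {G : SimpleGraph V}

/-- The edge `e` separates `x` from `y`: no walk from `x` to `y` avoids `e`. -/
def Separates (G : SimpleGraph V) (e : Sym2 V) (x y : V) : Prop :=
  ¬ (G.deleteEdges {e}).Reachable x y

/-- A walk off the edge `e` also avoids every edge with an endpoint on the other side of `e`. -/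
theorem not_separates_of_separates_endpoint {e : Sym2 V} {x y u v : V}
    (hxy : ¬ G.Separates e x y) (hu : G.Separates e x u) : ¬ G.Separates s(u, v) x y := by
  classical
  simp only [Separates, not_not] at *
  obtain ⟨p⟩ := hxy
  refine ⟨p.transfer _ fun f hf => ?_⟩
  have hfG := p.edges_subset_edgeSet hf
  rw [edgeSet_deleteEdges] at hfG ⊢
  refine ⟨hfG.1, ?_⟩
  rintro rfl
  exact hu ⟨p.takeUntil u (p.fst_mem_support_of_mem_edges hf)⟩

theorem Connected.reachable_deleteEdges_or (hG : G.Connected) (u v x : V) :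
    (G.deleteEdges {s(u, v)}).Reachable x u ∨ (G.deleteEdges {s(u, v)}).Reachable x v := by
  obtain ⟨p⟩ := hG.preconnected x u
  induction p with
  | nil => exact Or.inl (Reachable.refl _)
  | @cons a b c h p ih =>
    by_cases he : s(a, b) = s(c, v)
    · rcases Sym2.eq_iff.1 he with ⟨rfl, rfl⟩ | ⟨rfl, rfl⟩
      · exact Or.inl (Reachable.refl _)
      · exact Or.inr (Reachable.refl _)
    · have hab : (G.deleteEdges {s(c, v)}).Reachable a b := by
        apply Adj.reachable
        rw [deleteEdges_adj]
        exact ⟨h, he⟩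
      exact ih.imp hab.trans hab.trans

/-- Removing an edge leaves at most two components. -/
theorem Connected.not_separates_of_separates_of_separates (hG : G.Connected) {e : Sym2 V}
    {x y z : V} (hxy : G.Separates e x y) (hxz : G.Separates e x z) : ¬ G.Separates e y z := by
  induction e with
  | _ u v =>
    simp only [Separates, not_not] at *
    rcases hG.reachable_deleteEdges_or u v x with hx | hx <;>
    rcases hG.reachable_deleteEdges_or u v y with hy | hy <;>
    rcases hG.reachable_deleteEdges_or u v z with hz | hz <;>
    first
      | exact hy.trans hz.symm
      | exact (hxy (hx.trans hy.symm)).elim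
      | exact (hxz (hx.trans hz.symm)).elim

/-- The sides of two edges of a connected graph are nested. -/
theorem Connected.separates_of_separates (hG : G.Connected) {e f : Sym2 V} (hf : f ∈ G.edgeSet)
    {a b c d : V} (hed : G.Separates e a d) (hfd : G.Separates f a d)
    (hec : ¬ G.Separates e a c) (hfc : G.Separates f a c) (heb : G.Separates e a b) :
    G.Separates f a b := by
  induction f with
  | _ u v =>
    intro hfb
    -- The cases are the two sides of `e` on which the end `u` of `f` can lie; a walk staying on the
    -- other side cannot use `f`.
    by_cases hu : G.Separates e a u
    · exact not_separates_of_separates_endpoint hec hu hfc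
    · have hdb := hG.not_separates_of_separates_of_separates hed heb
      have hdu : G.Separates e d u := fun h => hed ((not_not.1 hu).trans h.symm)
      have := not_not.1 (not_separates_of_separates_endpoint (v := v) hdb hdu)
      exact hfd (hfb.trans this.symm)

/-- Among the points of `A` other than `a` and `d`, one branches off first from the
path from `a` to `d`: the edges of this path up to that branch have only `a` on their side. -/
theorem Connected.exists_first_branch [Finite V] (hG : G.Connected) {A : Set V}
    {a d : V} (hd : d ∈ A) (hA : ∃ b ∈ A, b ≠ a ∧ b ≠ d) :
    ∃ b ∈ A, b ≠ a ∧ b ≠ d ∧ ∀ e ∈ G.edgeSet, G.Separates e a b → G.Separates e a d →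
      ∀ c ∈ A, c ≠ a → G.Separates e a c := by
  classical
  let S : V → Set (Sym2 V) := fun b => {e | e ∈ G.edgeSet ∧ G.Separates e a b ∧ G.Separates e a d}
  obtain ⟨b, ⟨hb, hba, hbd⟩, hmin⟩ := Set.exists_min_image {b | b ∈ A ∧ b ≠ a ∧ b ≠ d}
    (fun b => (S b).ncard) (Set.toFinite _) hA
  refine ⟨b, hb, hba, hbd, fun e he heb hed c hc hca => ?_⟩
  by_contra hec
  have hcd : c ≠ d := by rintro rfl; exact hec hed
  -- A point `c` on the side of `a` branches off strictly earlier than `b`: `S c` lies in `S b` by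
  -- nestedness and misses `e`.
  refine (hmin c ⟨hc, hca, hcd⟩).not_gt (Set.ncard_lt_ncard ?_ (Set.toFinite _))
  rw [Set.ssubset_iff_of_subset]
  · exact ⟨e, ⟨he, heb, hed⟩, fun h => hec h.2.1⟩
  · rintro f ⟨hf, hfc, hfd⟩
    exact ⟨hf, hG.separates_of_separates hf hed hfd hec hfc heb, hfd⟩

/-! ### Increments of a real function along the edges of a tree. -/

/-- The absolute difference of `g` along an edge. -/
def edgeDiff (g : V → ℝ) : Sym2 V → ℝ :=
  Sym2.lift ⟨fun x y => |g x - g y|, fun x y => abs_sub_comm (g x) (g y)⟩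

theorem edgeDiff_nonneg (g : V → ℝ) (e : Sym2 V) : 0 ≤ edgeDiff g e := by
  induction e with
  | _ x y => exact abs_nonneg _

theorem Walk.abs_sub_le_sum_edgeDiff (g : V → ℝ) {x y : V} (p : G.Walk x y) :
    |g x - g y| ≤ (p.edges.map (edgeDiff g)).sum := by
  induction p with
  | nil => simp
  | @cons a b c h p ih =>
    simp only [Walk.edges_cons, List.map_cons, List.sum_cons]
    have : edgeDiff g s(a, b) = |g a - g b| := rfl
    linarith [abs_sub_le (g a) (g b) (g c)]

/-- A walk avoiding `e` would contain a second path from `x` to `y`. -/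
theorem IsTree.separates_of_mem_edges (hG : G.IsTree) {x y : V} {p : G.Walk x y}
    (hp : p.IsPath) {e : Sym2 V} (he : e ∈ p.edges) : G.Separates e x y := by
  classical
  rintro ⟨q⟩
  have hq : ∀ f ∈ q.bypass.edges, f ∈ G.edgeSet ∧ f ≠ e := fun f hf => by
    have := q.bypass.edges_subset_edgeSet hf
    rw [edgeSet_deleteEdges] at this
    exact ⟨this.1, this.2⟩
  have h : q.bypass.transfer G (fun f hf => (hq f hf).1) = p :=
    congrArg Subtype.val ((hG.2.subsingleton_path x y).elim
      ⟨_, q.bypass_isPath.transfer _⟩ ⟨p, hp⟩)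
  rw [← h, Walk.edges_transfer] at he
  exact (hq e he).2 rfl

open Classical in
/-- The increments of `g` along the edges separating `x` from `y` bound `|g x - g y|`. -/
theorem IsTree.abs_sub_le_sum_separates [Fintype G.edgeSet] (hG : G.IsTree) (g : V → ℝ)
    (x y : V) : |g x - g y| ≤ ∑ e ∈ G.edgeFinset with G.Separates e x y, edgeDiff g e := by
  obtain ⟨p, hp, -⟩ := hG.existsUnique_path x y
  refine (p.abs_sub_le_sum_edgeDiff g).trans ?_
  rw [← List.sum_toFinset _ hp.isTrail.edges_nodup]
  refine Finset.sum_le_sum_of_subset_of_nonneg (fun e he => ?_) fun e _ _ => edgeDiff_nonneg g e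
  rw [List.mem_toFinset] at he
  rw [Finset.mem_filter, mem_edgeFinset]
  exact ⟨p.edges_subset_edgeSet he, hG.separates_of_mem_edges hp he⟩

theorem edgeDiff_max_add_edgeDiff_min (g : V → ℝ) (e : Sym2 V) :
    edgeDiff (fun x => max (g x) 0) e + edgeDiff (fun x => min (g x) 0) e = edgeDiff g e := by
  induction e with
  | _ x y =>
    change |max (g x) 0 - max (g y) 0| + |min (g x) 0 - min (g y) 0| = |g x - g y|
    grind

/-- The edge `e` has `a` alone, among the points of `A`, on one of its sides. -/
def Isolates (G : SimpleGraph V) (A : Set V) (e : Sym2 V) (a : V) : Prop :=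
  ∀ c ∈ A, c ≠ a → G.Separates e a c

open Classical in
/-- If `g` is `1` at `a`, `-1` at `d` and vanishes at the other points of `A`, then the edges which
isolate `a` or `d`, or do not separate them, carry a total increment of `g` at least `2`. -/
theorem IsTree.two_le_sum_edgeDiff [Finite V] [Fintype G.edgeSet] (hG : G.IsTree) {A : Set V}
    {a d : V} (ha : a ∈ A) (hd : d ∈ A) {g : V → ℝ} (hga : g a = 1) (hgd : g d = -1)
    (hg : ∀ b ∈ A, b ≠ a → b ≠ d → g b = 0) :
    2 ≤ ∑ e ∈ G.edgeFinset with
      (¬ G.Separates e a d ∨ G.Isolates A e a ∨ G.Isolates A e d), edgeDiff g e := by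
  by_cases hA : ∃ b ∈ A, b ≠ a ∧ b ≠ d
  · have key : ∀ (h : V → ℝ) (x y : V), y ∈ A → (∃ b ∈ A, b ≠ x ∧ b ≠ y) →
        |h x| = 1 → (∀ b ∈ A, b ≠ x → b ≠ y → h b = 0) →
        1 ≤ ∑ e ∈ G.edgeFinset with (¬ G.Separates e x y ∨ G.Isolates A e x), edgeDiff h e := by
      intro h x y hy hxy hx hb
      obtain ⟨b, hbA, hbx, hby, hbe⟩ := hG.1.exists_first_branch hy hxy
      have h1 := hG.abs_sub_le_sum_separates h x b
      rw [hb b hbA hbx hby, sub_zero, hx] at h1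
      refine h1.trans (Finset.sum_le_sum_of_subset_of_nonneg (fun e he => ?_)
        fun e _ _ => edgeDiff_nonneg h e)
      rw [Finset.mem_filter] at he ⊢
      refine ⟨he.1, ?_⟩
      by_cases hs : G.Separates e x y
      · exact Or.inr (hbe e (mem_edgeFinset.1 he.1) he.2 hs)
      · exact Or.inl hs
    -- The positive part is charged to a path starting at `a`, the negative part to one starting at
    -- `d`. Their increments add up to those of `g`, so edges common to both paths are not
    -- overcounted.
    have h1 := key (fun x => max (g x) 0) a d hd hA (by simp [hga])
      (fun b hb h h' => by simp [hg b hb h h'])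
    have h2 := key (fun x => min (g x) 0) d a ha (by simpa only [and_comm] using hA)
      (by simp [hgd]) (fun b hb h h' => by simp [hg b hb h' h])
    simp_rw [← edgeDiff_max_add_edgeDiff_min g, Finset.sum_add_distrib]
    have mono : ∀ (h : V → ℝ) (P Q : Sym2 V → Prop) [DecidablePred P] [DecidablePred Q],
        (∀ e, P e → Q e) →
        ∑ e ∈ G.edgeFinset with P e, edgeDiff h e ≤ ∑ e ∈ G.edgeFinset with Q e, edgeDiff h e :=
      fun h P Q _ _ hPQ => Finset.sum_le_sum_of_subset_of_nonneg
        (Finset.monotone_filter_right _ fun e _ => hPQ e) fun e _ _ => edgeDiff_nonneg h e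
    have h3 := h1.trans (mono _ (fun e => ¬ G.Separates e a d ∨ G.Isolates A e a) (fun e => ¬ G.Separates e a d ∨ G.Isolates A e a ∨
      G.Isolates A e d) (fun e he => he.imp_right Or.inl))
    have h4 := h2.trans (mono _ (fun e => ¬ G.Separates e d a ∨ G.Isolates A e d) (fun e => ¬ G.Separates e a d ∨ G.Isolates A e a ∨
      G.Isolates A e d) (fun e he => he.imp (fun h h' => h fun h'' => h' h''.symm) Or.inr))
    linarith
  -- Here `A` contains only `a` and `d`, so any edge separating them isolates `a`.
  · have h1 := hG.abs_sub_le_sum_separates g a d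
    rw [hga, hgd] at h1
    norm_num at h1
    refine h1.trans (Finset.sum_le_sum_of_subset_of_nonneg (fun e he => ?_)
        fun e _ _ => edgeDiff_nonneg g e)
    rw [Finset.mem_filter] at he ⊢
    refine ⟨he.1, Or.inr (Or.inl fun c hc hca => ?_)⟩
    have : c = d := by by_contra h; exact hA ⟨c, hc, hca, h⟩
    exact this ▸ he.2

end SimpleGraph

/-! ### The norm and the points ±eᵢ. -/

theorem l1AddL2_apply (n : ℕ) (lam : ℝ) (hlam : 0 < lam) (x : Fin n → ℝ) :
    l1AddL2 n lam hlam x = ∑ i, |x i| + lam * √(∑ i, x i ^ 2) := by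
  change ‖WithLp.toLp 1 x‖ + lam * ‖WithLp.toLp 2 x‖ = _
  rw [PiLp.norm_eq_of_L1, EuclideanSpace.norm_eq]
  simp

theorem abs_le_sqrt_sum_sq {ι : Type*} [Fintype ι] (x : ι → ℝ) (i : ι) :
    |x i| ≤ √(∑ j, x j ^ 2) :=
  Real.abs_le_sqrt (Finset.single_le_sum (f := fun j => x j ^ 2)
    (fun _ _ => sq_nonneg _) (Finset.mem_univ i))

open Classical in
/-- The functionals `∑ i ∈ S, ± lam xᵢ + ∑ i ∉ S, ± xᵢ` have dual norm at most one. -/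
theorem sum_weighted_abs_le_l1AddL2 (n : ℕ) (lam : ℝ) (hlam : 0 < lam)
    (h : (lam - 1) * √(n : ℝ) ≤ lam) (P : Fin n → Prop) (x : Fin n → ℝ) :
    ∑ i, (if P i then lam * |x i| else |x i|) ≤ l1AddL2 n lam hlam x := by
  rw [l1AddL2_apply]
  have h0 : 0 ≤ √(∑ i, x i ^ 2) := Real.sqrt_nonneg _
  rcases le_total lam 1 with h1 | h1
  · refine le_add_of_le_of_nonneg (Finset.sum_le_sum fun i _ => ?_) (by positivity)
    split_ifs
    · nlinarith [abs_nonneg (x i)]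
    · exact le_rfl
  -- For `1 ≤ lam` the worst case has weight `lam` everywhere; Cauchy–Schwarz bounds the excess (lam
  -- - 1)‖x‖₁ by (lam - 1)√n ‖x‖₂ ≤ lam ‖x‖₂.
  · have hs : ∑ i, |x i| ≤ √(n : ℝ) * √(∑ i, x i ^ 2) := by
      rw [← Real.sqrt_mul (Nat.cast_nonneg n)]
      apply Real.le_sqrt_of_sq_le
      have := sq_sum_le_card_mul_sum_sq (s := Finset.univ) (f := fun i => |x i|)
      simpa using this
    have h2 : ∑ i, (if P i then lam * |x i| else |x i|) ≤ ∑ i, lam * |x i| := by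
      refine Finset.sum_le_sum fun i _ => ?_
      split_ifs
      · exact le_rfl
      · nlinarith [abs_nonneg (x i)]
    rw [← Finset.mul_sum] at h2
    have h3 := mul_le_mul_of_nonneg_left hs (sub_nonneg.2 h1)
    have h4 := mul_le_mul_of_nonneg_right h h0
    nlinarith

theorem mem_crossPoints {n : ℕ} {x : Fin n → ℝ} :
    x ∈ crossPoints n ↔ ∃ i, x = Pi.single i 1 ∨ x = -Pi.single i 1 := by
  simp only [crossPoints, Finset.mem_union, Finset.mem_image, Finset.mem_univ, true_and]
  constructor
  · rintro (⟨i, rfl⟩ | ⟨i, rfl⟩)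
    · exact ⟨i, Or.inl rfl⟩
    · exact ⟨i, Or.inr rfl⟩
  · rintro ⟨i, rfl | rfl⟩
    · exact Or.inl ⟨i, rfl⟩
    · exact Or.inr ⟨i, rfl⟩

theorem single_mem_crossPoints {n : ℕ} (i : Fin n) : Pi.single i (1 : ℝ) ∈ crossPoints n :=
  mem_crossPoints.2 ⟨i, Or.inl rfl⟩

theorem neg_single_mem_crossPoints {n : ℕ} (i : Fin n) : -Pi.single i (1 : ℝ) ∈ crossPoints n :=
  mem_crossPoints.2 ⟨i, Or.inr rfl⟩

theorem zero_notMem_crossPoints (n : ℕ) : (0 : Fin n → ℝ) ∉ crossPoints n := by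
  rw [mem_crossPoints]
  rintro ⟨i, h | h⟩ <;> simpa using congrFun h i

theorem single_ne_neg_single {n : ℕ} (i j : Fin n) :
    (Pi.single i (1 : ℝ) : Fin n → ℝ) ≠ -Pi.single j 1 := by
  intro h
  have := congrFun h i
  by_cases hij : i = j
  · subst hij; norm_num at this
  · simp [hij] at this

theorem single_one_injective (n : ℕ) :
    Function.Injective (fun i : Fin n => (Pi.single i (1 : ℝ) : Fin n → ℝ)) := by
  intro i j h
  by_contra hij
  simpa [hij] using congrFun h i

theorem card_crossPoints (n : ℕ) : (crossPoints n).card = 2 * n := by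
  rw [crossPoints, Finset.card_union_of_disjoint, Finset.card_image_of_injective,
    Finset.card_image_of_injective]
  · simp [two_mul]
  · exact fun i j h => single_one_injective n (neg_injective h)
  · exact single_one_injective n
  · rw [Finset.disjoint_left]
    simp only [Finset.mem_image, Finset.mem_univ, true_and]
    rintro _ ⟨i, rfl⟩ ⟨j, h⟩
    exact single_ne_neg_single i j h.symm

theorem l1AddL2_single (n : ℕ) (lam : ℝ) (hlam : 0 < lam) (i : Fin n) :
    l1AddL2 n lam hlam (Pi.single i 1) = 1 + lam := by
  rw [l1AddL2_apply, Finset.sum_eq_single i, Finset.sum_eq_single i] <;> simp +contextual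

theorem l1AddL2_of_mem_crossPoints {n : ℕ} {lam : ℝ} {hlam : 0 < lam} {x : Fin n → ℝ}
    (hx : x ∈ crossPoints n) : l1AddL2 n lam hlam x = 1 + lam := by
  obtain ⟨i, rfl | rfl⟩ := mem_crossPoints.1 hx
  · exact l1AddL2_single n lam hlam i
  · rw [map_neg_eq_map]; exact l1AddL2_single n lam hlam i

/-! ### Length and degree of the star. -/

namespace PointTree

open SimpleGraph

open Classical in
theorem length_star_le {E : Type*} [AddCommGroup E] [Module ℝ E] (p : Seminorm ℝ E) (c : E)
    (A : Finset E) : (star c A).length p ≤ ∑ x ∈ A, p (c - x) := by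
  let r : (star c A).verts := ⟨c, centre_mem_star c A⟩
  have hsub : (star c A).graph.edgeFinset ⊆ Finset.univ.image fun x => s(r, x) := by
    intro e he
    rw [mem_edgeFinset] at he
    induction e with
    | _ x y =>
      rw [mem_edgeSet] at he
      rw [Finset.mem_image]
      rcases (starGraph_adj.1 he).2 with h | h
      · exact ⟨y, Finset.mem_univ _, by rw [h]; rfl⟩
      · exact ⟨x, Finset.mem_univ _, by rw [h, Sym2.eq_swap]; rfl⟩
  refine (Finset.sum_le_sum_of_subset_of_nonneg hsub fun e _ _ => ?_).trans ?_
  · induction e with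
    | _ x y => exact apply_nonneg p _
  · rw [Finset.sum_image fun x _ y _ h => Sym2.congr_right.1 h]
    refine (Finset.sum_coe_sort (insert c A) fun x => p (c - x)).le.trans ?_
    -- The image above also contains the loop at the centre, which has length zero.
    rw [Finset.sum_insert_zero (by rw [sub_self, map_zero])]

theorem mem_verts_star {E : Type*} {c : E} {A : Finset E} {x : E} :
    x ∈ (star c A).verts ↔ x = c ∨ x ∈ A := by
  classical
  simp [star]

theorem length_crossStar_le (n : ℕ) (lam : ℝ) (hlam : 0 < lam) :
    (crossStar n).length (l1AddL2 n lam hlam) ≤ n * (2 * lam + 2) := by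
  refine (length_star_le _ _ _).trans ?_
  rw [Finset.sum_congr rfl fun x hx => by
      rw [zero_sub, map_neg_eq_map, l1AddL2_of_mem_crossPoints hx], Finset.sum_const,
    card_crossPoints, nsmul_eq_mul]
  push_cast
  linarith

theorem degree_crossStar (n : ℕ) :
    (crossStar n).degree ⟨0, zero_mem_crossStar n⟩ = ((2 * n : ℕ) : ℕ∞) := by
  have h : (Subtype.val '' (crossStar n).graph.neighborSet ⟨0, zero_mem_crossStar n⟩) =
      (crossPoints n : Set (Fin n → ℝ)) := by
    ext x
    constructor
    · rintro ⟨y, hy, rfl⟩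
      refine (mem_verts_star.1 y.2).resolve_left fun h => ?_
      exact ((crossStar n).graph.ne_of_adj hy) (Subtype.ext h.symm)
    · intro hx
      refine ⟨⟨x, mem_verts_star.2 (Or.inr hx)⟩, starGraph_center_adj fun h => ?_, rfl⟩
      have h0 : (0 : Fin n → ℝ) = x := Subtype.ext_iff.1 h
      exact zero_notMem_crossPoints n (h0 ▸ hx)
  rw [PointTree.degree, ← Subtype.val_injective.encard_image, h, Set.encard_coe_eq_coe_finsetCard,
    card_crossPoints]

end PointTree

/-! ### Minimality of the star. -/

namespace PointTree

open SimpleGraph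

variable {n : ℕ}

/-- The length of the edge `e` bounds its coordinate increments, counted `lam` times if `e`
separates `eᵢ` from `-eᵢ`, and once if `e` does not separate them or isolates one of them. -/
theorem sum_weighted_edgeDiff_le {lam : ℝ} (hlam : 0 < lam) (h : (lam - 1) * √(n : ℝ) ≤ lam)
    (T : PointTree (Fin n → ℝ)) (A : Set T.verts) (a d : Fin n → T.verts)
    (haA : ∀ i, a i ∈ A) (hdA : ∀ i, d i ∈ A) (had : ∀ i j, a i ≠ d j)
    (ha : Function.Injective a) (hd : Function.Injective d) (S Q : Fin n → Prop)
    [DecidablePred S] [DecidablePred Q] (e : Sym2 T.verts)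
    (hS : ∀ i, S i ↔ T.graph.Separates e (a i) (d i))
    (hQ : ∀ i, Q i ↔ ¬ T.graph.Separates e (a i) (d i) ∨ T.graph.Isolates A e (a i) ∨
      T.graph.Isolates A e (d i)) :
    ∑ i, ((if S i then lam * edgeDiff (fun x : T.verts => x.1 i) e else 0) +
      (if Q i then edgeDiff (fun x : T.verts => x.1 i) e else 0)) ≤
    Sym2.lift ⟨fun x y : T.verts => l1AddL2 n lam hlam ((x : Fin n → ℝ) - (y : Fin n → ℝ)),
      fun _ _ => map_sub_rev (l1AddL2 n lam hlam) _ _⟩ e := by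
  classical
  have hlift : ∃ v : Fin n → ℝ, (∀ i, edgeDiff (fun x : T.verts => x.1 i) e = |v i|) ∧
      Sym2.lift ⟨fun x y : T.verts => l1AddL2 n lam hlam ((x : Fin n → ℝ) - (y : Fin n → ℝ)),
      fun _ _ => map_sub_rev (l1AddL2 n lam hlam) _ _⟩ e = l1AddL2 n lam hlam v := by
    induction e with
    | _ x y => exact ⟨x.1 - y.1, fun i => rfl, rfl⟩
  obtain ⟨v, hv, hlen⟩ := hlift
  rw [hlen]
  simp_rw [hv]
  have hconn := T.isTree.1
  by_cases hiso : ∃ i, T.graph.Isolates A e (a i) ∨ T.graph.Isolates A e (d i)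
  · obtain ⟨i, hi⟩ := hiso
    -- For `j ≠ i`, both `a j` and `d j` lie across `e` from the isolated point, hence on the same
    -- side.
    have hns : ∀ j, j ≠ i → ¬ S j := by
      intro j hj
      rw [hS]
      rcases hi with hi | hi
      · exact hconn.not_separates_of_separates_of_separates
          (hi _ (haA j) (ha.ne hj)) (hi _ (hdA j) (had i j).symm)
      · exact hconn.not_separates_of_separates_of_separates
          (hi _ (haA j) (had j i)) (hi _ (hdA j) (hd.ne hj))
    -- The ℓ₁ part pays for the `Q` terms, the ℓ₂ part for the single possible `S` term.
    rw [l1AddL2_apply, Finset.sum_add_distrib, add_comm]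
    refine add_le_add (Finset.sum_le_sum fun j _ => ?_) ?_
    · split_ifs
      · exact le_rfl
      · exact abs_nonneg _
    · rw [Finset.sum_eq_single i (fun j _ hj => if_neg (hns j hj))
        (fun hi => (hi (Finset.mem_univ i)).elim)]
      split_ifs
      · exact mul_le_mul_of_nonneg_left (abs_le_sqrt_sum_sq v i) hlam.le
      · positivity
  · refine le_trans (Finset.sum_le_sum fun i _ => ?_)
      (sum_weighted_abs_le_l1AddL2 n lam hlam h S v)
    have hi : Q i ↔ ¬ S i := by
      rw [hQ, hS]
      exact or_iff_left fun h' => hiso ⟨i, h'⟩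
    by_cases hs : S i
    · simp [hi, hs]
    · simp [hi, hs]

-- Summing the edgewise bound and exchanging the sums leaves, for each coordinate, a contribution of
-- at least 2 lam from the separating edges and 2 from the others counted.
open Classical in
theorem le_length_of_isSteinerTree_crossPoints {lam : ℝ} (hlam : 0 < lam)
    (h : (lam - 1) * √(n : ℝ) ≤ lam) (T : PointTree (Fin n → ℝ))
    (hT : T.IsSteinerTree (crossPoints n)) :
    n * (2 * lam + 2) ≤ T.length (l1AddL2 n lam hlam) := by
  let A : Set T.verts := {x | x.1 ∈ crossPoints n}
  let a : Fin n → T.verts := fun i => ⟨Pi.single i 1, hT (single_mem_crossPoints i)⟩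
  let d : Fin n → T.verts := fun i => ⟨-Pi.single i 1, hT (neg_single_mem_crossPoints i)⟩
  have haA : ∀ i, a i ∈ A := single_mem_crossPoints
  have hdA : ∀ i, d i ∈ A := neg_single_mem_crossPoints
  have had : ∀ i j, a i ≠ d j := fun i j hij =>
    single_ne_neg_single i j (congrArg Subtype.val hij)
  have ha : Function.Injective a := fun i j hij =>
    single_one_injective n (congrArg Subtype.val hij)
  have hd : Function.Injective d := fun i j hij =>
    single_one_injective n (neg_injective (congrArg Subtype.val hij))
  unfold length
  refine le_trans ?_ (Finset.sum_le_sum fun e _ => sum_weighted_edgeDiff_le hlam h T A a d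
    haA hdA had ha hd (fun i => T.graph.Separates e (a i) (d i))
    (fun i => ¬ T.graph.Separates e (a i) (d i) ∨ T.graph.Isolates A e (a i) ∨
      T.graph.Isolates A e (d i)) e (fun _ => Iff.rfl) fun _ => Iff.rfl)
  rw [Finset.sum_comm]
  have hcard : (n : ℝ) * (2 * lam + 2) = ∑ _i : Fin n, (2 * lam + 2) := by
    rw [Finset.sum_const, Finset.card_univ, Fintype.card_fin, nsmul_eq_mul]
  rw [hcard]
  refine Finset.sum_le_sum fun i _ => ?_
  rw [Finset.sum_add_distrib, ← Finset.sum_filter, ← Finset.sum_filter, ← Finset.mul_sum]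
  have hai : (a i).1 i = 1 := Pi.single_eq_same i 1
  have hdi : (d i).1 i = -1 := by simp [d]
  have h1 := T.isTree.abs_sub_le_sum_separates (fun x : T.verts => x.1 i) (a i) (d i)
  have h2 := T.isTree.two_le_sum_edgeDiff (haA i) (hdA i) (g := fun x : T.verts => x.1 i)
    hai hdi (by
      intro b hb hba hbd
      obtain ⟨j, hj⟩ := mem_crossPoints.1 hb
      have hij : i ≠ j := by
        rintro rfl
        rcases hj with hj | hj
        · exact hba (Subtype.ext hj)
        · exact hbd (Subtype.ext hj)
      rcases hj with hj | hj <;> simp [hj, hij])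
  rw [hai, hdi] at h1
  norm_num at h1
  have h3 := mul_le_mul_of_nonneg_left h1 hlam.le
  linarith

theorem isSMT_crossStar {lam : ℝ} (hlam : 0 < lam) (h : (lam - 1) * √(n : ℝ) ≤ lam) :
    (crossStar n).IsSMT (l1AddL2 n lam hlam) (crossPoints n) :=
  ⟨fun _ hx => mem_verts_star.2 (Or.inr hx), fun T hT => (length_crossStar_le n lam hlam).trans
    (le_length_of_isSteinerTree_crossPoints hlam h T hT)⟩

end PointTree

/-- Declaring a Steiner point to be given keeps the tree minimal, since enlarging `N` only removes
competitors. -/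
theorem maxSteinerDegree_le_maxNodeDegree {E : Type*} [AddCommGroup E] [Module ℝ E]
    (p : Seminorm ℝ E) : maxSteinerDegree p ≤ maxNodeDegree p := by
  classical
  refine iSup_le fun N => iSup_le fun T => iSup_le fun hT => iSup_le fun v => iSup_le fun _ => ?_
  have h : T.IsSMT p (insert v.1 N) :=
    ⟨Finset.insert_subset v.2 hT.1, fun T' hT' =>
      hT.2 T' ((Finset.subset_insert _ _).trans hT')⟩
  exact le_iSup_of_le (insert v.1 N) <| le_iSup_of_le T <| le_iSup_of_le h <|
    le_iSup_of_le v <| le_iSup_of_le (Finset.mem_insert_self _ _) le_rfl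

/-! ### Local exchange in a Steiner minimal tree. -/

namespace PointTree

open SimpleGraph

variable {E : Type*} [AddCommGroup E] [Module ℝ E]

/-- The length of a pair of points for the norm `p`. -/
def pairLength (p : Seminorm ℝ E) : Sym2 E → ℝ :=
  Sym2.lift ⟨fun x y => p (x - y), fun _ _ => map_sub_rev p _ _⟩

theorem pairLength_nonneg (p : Seminorm ℝ E) (e : Sym2 E) : 0 ≤ pairLength p e := by
  induction e with
  | _ x y => exact apply_nonneg p _

open Classical in
/-- The edges of a tree as pairs of points of the ambient space. -/
noncomputable def edges {E : Type*} (T : PointTree E) : Finset (Sym2 E) :=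
  T.graph.edgeFinset.image (Sym2.map Subtype.val)

open Classical in
theorem mem_edges {E : Type*} {T : PointTree E} {x y : T.verts} :
    s(x.1, y.1) ∈ T.edges ↔ T.graph.Adj x y := by
  rw [edges, Finset.mem_image, ← mem_edgeSet, ← Sym2.map_mk]
  constructor
  · rintro ⟨e, he, h⟩
    rwa [← Sym2.map.injective Subtype.val_injective h, ← mem_edgeFinset]
  · exact fun h => ⟨_, mem_edgeFinset.2 h, rfl⟩

-- With edges seen as pairs in `E`, trees on different vertex sets can be compared.
open Classical in
theorem length_eq_sum_edges (p : Seminorm ℝ E) (T : PointTree E) :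
    T.length p = ∑ e ∈ T.edges, pairLength p e := by
  rw [edges, Finset.sum_image fun _ _ _ _ h => Sym2.map.injective Subtype.val_injective h]
  refine Finset.sum_congr rfl fun e _ => ?_
  induction e with
  | _ x y => rfl

open Classical in
/-- A connected network of segments contains a tree with the same vertices. -/
theorem exists_length_le (p : Seminorm ℝ E) (S : Finset E) (F : Finset (Sym2 E))
    (h : ((fromEdgeSet (F : Set (Sym2 E))).comap (Subtype.val : S → E)).Connected) :
    ∃ T : PointTree E, T.verts = S ∧ T.length p ≤ ∑ e ∈ F, pairLength p e := by
  obtain ⟨H, hle, hH⟩ := h.exists_isTree_le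
  refine ⟨⟨S, H, hH⟩, rfl, ?_⟩
  rw [length_eq_sum_edges]
  refine Finset.sum_le_sum_of_subset_of_nonneg (fun e he => ?_) fun e _ _ => pairLength_nonneg p e
  obtain ⟨e, he', rfl⟩ := Finset.mem_image.1 he
  rw [mem_edgeFinset] at he'
  induction e with
  | _ x y => exact ((fromEdgeSet_adj _).1 (hle he')).1

open Classical in
/-- If `v` is adjacent to `x` and `y` in a Steiner minimal tree, the path `x v y` is no longer
than any star joining `v`, `x` and `y`. -/
theorem IsSMT.add_le {p : Seminorm ℝ E} {T : PointTree E} {N : Finset E} (hT : T.IsSMT p N)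
    {v x y : T.verts} (hx : T.graph.Adj v x) (hy : T.graph.Adj v y) (hxy : x ≠ y) (z : E) :
    p (x.1 - v) + p (y.1 - v) ≤ p (z - v) + p (x - z) + p (y - z) := by
  let F₀ : Finset (Sym2 E) := (T.edges.erase s(v.1, x.1)).erase s(v.1, y.1)
  let F : Finset (Sym2 E) := F₀ ∪ {s(v.1, z), s(x.1, z), s(y.1, z)}
  let S : Finset E := insert z T.verts
  let i : T.verts → S := fun w => ⟨w.1, Finset.mem_insert_of_mem w.2⟩
  let z' : S := ⟨z, Finset.mem_insert_self _ _⟩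
  let H := (fromEdgeSet (F : Set (Sym2 E))).comap (Subtype.val : S → E)
  have hreach : ∀ a b : S, s(a.1, b.1) ∈ F → H.Reachable a b := by
    intro a b hab
    by_cases h : a = b
    · exact h ▸ Reachable.refl _
    · exact Adj.reachable ((fromEdgeSet_adj _).2 ⟨hab, fun h' => h (Subtype.ext h')⟩)
  have hv : H.Reachable (i v) z' := hreach _ _ (by simp [F, i, z'])
  have hx' : H.Reachable (i x) z' := hreach _ _ (by simp [F, i, z'])
  have hy' : H.Reachable (i y) z' := hreach _ _ (by simp [F, i, z'])
  have hadj : ∀ a b : T.verts, T.graph.Adj a b → H.Reachable (i a) (i b) := by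
    intro a b hab
    by_cases h1 : s(a, b) = s(v, x)
    · rcases Sym2.eq_iff.1 h1 with ⟨rfl, rfl⟩ | ⟨rfl, rfl⟩
      · exact hv.trans hx'.symm
      · exact hx'.trans hv.symm
    by_cases h2 : s(a, b) = s(v, y)
    · rcases Sym2.eq_iff.1 h2 with ⟨rfl, rfl⟩ | ⟨rfl, rfl⟩
      · exact hv.trans hy'.symm
      · exact hy'.trans hv.symm
    refine hreach _ _ (Finset.mem_union_left _ (Finset.mem_erase.2 ⟨fun h => h2 ?_,
      Finset.mem_erase.2 ⟨fun h => h1 ?_, mem_edges.2 hab⟩⟩))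
    · exact Sym2.map.injective Subtype.val_injective h
    · exact Sym2.map.injective Subtype.val_injective h
  have hz : ∀ a : S, H.Reachable a z' := by
    rintro ⟨a, ha⟩
    rcases Finset.mem_insert.1 ha with rfl | ha
    · exact Reachable.refl _
    · refine Reachable.trans (v := i v) ?_ hv
      obtain ⟨q⟩ := T.isTree.1.preconnected ⟨a, ha⟩ v
      have : ∀ {b c : T.verts}, T.graph.Walk b c → H.Reachable (i b) (i c) := by
        intro b c q
        induction q with
        | nil => exact Reachable.refl _
        | cons h q ih => exact (hadj _ _ h).trans ih
      exact this q
  have hH : H.Connected :=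
    (connected_iff _).2 ⟨fun a b => (hz a).trans (hz b).symm, ⟨z'⟩⟩
  obtain ⟨T', hT'S, hT'len⟩ := exists_length_le p S F hH
  have hle := (hT.2 T' (by
    rw [IsSteinerTree, hT'S]
    exact hT.1.trans (Finset.subset_insert _ _))).trans hT'len
  have hF : ∑ e ∈ F, pairLength p e ≤
      ∑ e ∈ F₀, pairLength p e + (p (v - z) + (p (x - z) + p (y - z))) := by
    have h3 : ∑ e ∈ ({s(v.1, z), s(x.1, z), s(y.1, z)} : Finset (Sym2 E)), pairLength p e ≤
        p (v - z) + (p (x - z) + p (y - z)) := by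
      have hins : ∀ (e : Sym2 E) (s : Finset (Sym2 E)),
          ∑ f ∈ insert e s, pairLength p f ≤ pairLength p e + ∑ f ∈ s, pairLength p f := by
        intro e s
        by_cases he : e ∈ s
        · rw [Finset.insert_eq_of_mem he]
          linarith [pairLength_nonneg p e]
        · rw [Finset.sum_insert he]
      refine (hins _ _).trans (add_le_add le_rfl ((hins _ _).trans (add_le_add le_rfl ?_)))
      rw [Finset.sum_singleton]
      rfl
    -- If `z` is already a vertex, some new segments may already be in `F₀`; the overlap only lowers
    -- the total.
    have h4 := Finset.sum_union_inter (s₁ := F₀)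
      (s₂ := {s(v.1, z), s(x.1, z), s(y.1, z)}) (f := pairLength p)
    have h5 : 0 ≤ ∑ e ∈ F₀ ∩ {s(v.1, z), s(x.1, z), s(y.1, z)}, pairLength p e :=
      Finset.sum_nonneg fun e _ => pairLength_nonneg p e
    linarith
  have hvx : s(v.1, x.1) ∈ T.edges := mem_edges.2 hx
  have hvy : s(v.1, y.1) ∈ T.edges.erase s(v.1, x.1) := Finset.mem_erase.2
    ⟨fun h => hxy (Subtype.ext (Sym2.congr_right.1 h)).symm, mem_edges.2 hy⟩
  rw [length_eq_sum_edges, ← Finset.add_sum_erase _ _ hvx, ← Finset.add_sum_erase _ _ hvy] at hle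
  have e1 : pairLength p s(v.1, x.1) = p (x.1 - v) := map_sub_rev p _ _
  have e2 : pairLength p s(v.1, y.1) = p (y.1 - v) := map_sub_rev p _ _
  have e3 : p (v.1 - z) = p (z - v) := map_sub_rev p _ _
  rw [e1, e2] at hle
  rw [e3] at hF
  linarith

end PointTree

/-! ### The degree bound for `lam ≤ 1`. -/

/-- Moving a coordinate towards zero by `t` decreases the norm by more than `t`. -/
theorem l1AddL2_sub_single_lt {n : ℕ} {lam : ℝ} (hlam : 0 < lam) (u : Fin n → ℝ) (j : Fin n)
    (σ t : ℝ) (hσ : |σ| = 1) (ht : 0 < t) (htu : t ≤ σ * u j) :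
    l1AddL2 n lam hlam (u - Pi.single j (σ * t)) < l1AddL2 n lam hlam u - t := by
  classical
  have hσ2 : σ = 1 ∨ σ = -1 := eq_or_eq_neg_of_abs_eq hσ
  have habs : |u j - σ * t| = |u j| - t ∧ (u j - σ * t) ^ 2 < u j ^ 2 := by
    rcases hσ2 with rfl | rfl
    · rw [abs_of_nonneg (by linarith), abs_of_nonneg (by linarith)]
      exact ⟨by ring, by nlinarith⟩
    · rw [abs_of_nonpos (by linarith), abs_of_nonpos (by linarith)]
      exact ⟨by ring, by nlinarith⟩
  have hrest : ∀ i ∈ Finset.univ.erase j, (u - Pi.single j (σ * t) : Fin n → ℝ) i = u i := by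
    intro i hi
    simp [Finset.ne_of_mem_erase hi]
  have hj : (u - Pi.single j (σ * t) : Fin n → ℝ) j = u j - σ * t := by simp
  have h1 : ∑ i, |(u - Pi.single j (σ * t) : Fin n → ℝ) i| = ∑ i, |u i| - t := by
    rw [← Finset.add_sum_erase _ _ (Finset.mem_univ j),
      ← Finset.add_sum_erase _ (fun i => |u i|) (Finset.mem_univ j),
      Finset.sum_congr rfl fun i hi => congrArg abs (hrest i hi), hj, habs.1]
    ring
  have h2 : ∑ i, (u - Pi.single j (σ * t) : Fin n → ℝ) i ^ 2 < ∑ i, u i ^ 2 := by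
    rw [← Finset.add_sum_erase _ _ (Finset.mem_univ j),
      ← Finset.add_sum_erase _ (fun i => u i ^ 2) (Finset.mem_univ j),
      Finset.sum_congr rfl fun i hi => congrArg (· ^ 2) (hrest i hi), hj]
    linarith [habs.2]
  rw [l1AddL2_apply, l1AddL2_apply, h1]
  have h3 := Real.sqrt_lt_sqrt (Finset.sum_nonneg fun i _ => sq_nonneg _) h2
  have h4 := mul_lt_mul_of_pos_left h3 hlam
  linarith

theorem l1AddL2_single_mul {n : ℕ} {lam : ℝ} (hlam : 0 < lam) (j : Fin n)
    {σ t : ℝ} (hσ : |σ| = 1) (ht : 0 < t) :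
    l1AddL2 n lam hlam (Pi.single j (σ * t)) = t * (1 + lam) := by
  have : (Pi.single j (σ * t) : Fin n → ℝ) = (σ * t) • Pi.single j 1 := by
    rw [← Pi.single_smul]; simp
  rw [this, map_smul_eq_mul, l1AddL2_single, norm_mul, Real.norm_eq_abs, hσ, Real.norm_eq_abs,
    abs_of_pos ht, one_mul]

/-- Two edges at a vertex of a Steiner minimal tree leave it in opposite closed directions with
respect to each coordinate, when `lam ≤ 1`. -/
theorem PointTree.IsSMT.eq_of_mul_pos {n : ℕ} {lam : ℝ} {hlam : 0 < lam} (hle : lam ≤ 1)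
    {T : PointTree (Fin n → ℝ)} {N : Finset (Fin n → ℝ)} (hT : T.IsSMT (l1AddL2 n lam hlam) N)
    {v x y : T.verts} (hx : T.graph.Adj v x) (hy : T.graph.Adj v y) (j : Fin n) (σ : ℝ)
    (hσ : |σ| = 1) (hxj : 0 < σ * (x.1 - v.1) j) (hyj : 0 < σ * (y.1 - v.1) j) : x = y := by
  by_contra hxy
  set t := min (σ * (x.1 - v.1) j) (σ * (y.1 - v.1) j) with ht
  have ht0 : 0 < t := lt_min hxj hyj
  have h1 := hT.add_le hx hy hxy (v.1 + Pi.single j (σ * t))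
  rw [add_sub_cancel_left, ← sub_sub, ← sub_sub, l1AddL2_single_mul hlam j hσ ht0] at h1
  have h2 := l1AddL2_sub_single_lt hlam (x.1 - v.1) j σ t hσ ht0 (min_le_left _ _)
  have h3 := l1AddL2_sub_single_lt hlam (y.1 - v.1) j σ t hσ ht0 (min_le_right _ _)
  -- The common segment costs t(1 + lam), and each of the two edges saves more than t, so the net
  -- change is below t(lam - 1) ≤ 0.
  nlinarith

theorem PointTree.IsSMT.degree_le {n : ℕ} (hn : 1 ≤ n) {lam : ℝ} {hlam : 0 < lam} (hle : lam ≤ 1)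
    {T : PointTree (Fin n → ℝ)} {N : Finset (Fin n → ℝ)} (hT : T.IsSMT (l1AddL2 n lam hlam) N)
    (v : T.verts) : T.degree v ≤ ((2 * n : ℕ) : ℕ∞) := by
  -- `choose!` needs a default value of `q` off the neighbours of `v`.
  have : Nonempty (Fin n) := ⟨⟨0, hn⟩⟩
  have hex : ∀ x : T.verts, T.graph.Adj v x → ∃ q : Bool × Fin n,
      0 < (if q.1 then (1 : ℝ) else -1) * (x.1 - v.1) q.2 := by
    intro x hx
    obtain ⟨j, hj⟩ := Function.ne_iff.1 fun h : x.1 = v.1 => hx.ne (Subtype.ext h.symm)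
    rcases (sub_ne_zero.2 hj).lt_or_gt with h | h
    · exact ⟨(false, j), by simpa using h⟩
    · exact ⟨(true, j), by simpa using h⟩
  choose! q hq using hex
  have hinj : Set.InjOn q (T.graph.neighborSet v) := by
    intro x hx y hy hxy
    refine hT.eq_of_mul_pos hle hx hy (q x).2 (if (q x).1 then 1 else -1)
      (by split_ifs <;> simp) (hq x hx) ?_
    rw [hxy]
    exact hq y hy
  have h := Set.encard_le_encard_of_injOn (t := Set.univ) (fun _ _ => Set.mem_univ _) hinj
  rw [Set.encard_univ, ENat.card_eq_coe_fintype_card, Fintype.card_prod, Fintype.card_bool,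
    Fintype.card_fin] at h
  exact h

theorem theorem4 (n : ℕ) (hn : 1 ≤ n) (lam : ℝ) (hlam : 0 < lam) :
    (lam ≤ 1 →
      maxSteinerDegree (l1AddL2 n lam hlam) ≤ maxNodeDegree (l1AddL2 n lam hlam) ∧
      maxNodeDegree (l1AddL2 n lam hlam) ≤ ((2 * n : ℕ) : ℕ∞)) ∧
    ((n ≠ 1 → lam ≤ √(n : ℝ) / (√(n : ℝ) - 1)) →
      maxSteinerDegree (l1AddL2 n lam hlam) ≤ maxNodeDegree (l1AddL2 n lam hlam) ∧
      ((2 * n : ℕ) : ℕ∞) ≤ maxSteinerDegree (l1AddL2 n lam hlam) ∧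
      (crossStar n).IsSMT (l1AddL2 n lam hlam) (crossPoints n) ∧
      (0 : Fin n → ℝ) ∉ crossPoints n ∧
      (crossStar n).degree ⟨0, zero_mem_crossStar n⟩ = ((2 * n : ℕ) : ℕ∞)) := by
  refine ⟨fun hle => ⟨maxSteinerDegree_le_maxNodeDegree _, ?_⟩,
    fun hle => ⟨maxSteinerDegree_le_maxNodeDegree _, ?_⟩⟩
  · exact iSup_le fun N => iSup_le fun T => iSup_le fun hT => iSup_le fun v => iSup_le fun _ =>
      hT.degree_le hn hle v
  -- Clearing the denominator √n - 1 gives a form that also holds for n = 1, where it reads lam - 1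
  -- ≤ lam.
  · have h : (lam - 1) * √(n : ℝ) ≤ lam := by
      by_cases h1 : n = 1
      · simp [h1]
      · have h2 : 1 < √(n : ℝ) := by
          rw [Real.lt_sqrt zero_le_one]
          exact_mod_cast (by omega : 1 ^ 2 < n)
        have h3 := (le_div_iff₀ (sub_pos.2 h2)).1 (hle h1)
        linarith
    have hS := PointTree.isSMT_crossStar hlam h
    refine ⟨?_, hS, zero_notMem_crossPoints n, PointTree.degree_crossStar n⟩
    exact le_iSup_of_le (crossPoints n) <| le_iSup_of_le (crossStar n) <| le_iSup_of_le hS <|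
      le_iSup_of_le ⟨0, zero_mem_crossStar n⟩ <|
      le_iSup_of_le (zero_notMem_crossPoints n) (PointTree.degree_crossStar n).ge
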